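/- For a finite multigraph $G$ with edge set $E$ (self-loops and multiple edges permitted), let $$\Psi_G=\sum_{T}\ \prod_{e\in E\setminus T}t_e\ \in\ \mathbb{Q}[t_e : e\in E]$$ be its Kirchhoff polynomial, where $T$ runs over the (edge sets of the) spanning trees of $G$; thus $\Psi_G=0$ if $G$ is disconnected. For a connected $G$ and an edge $e$ of $G$, *condition 1* for $(G,e)$ is the statement that $\Psi_G$ belongs to the Jacobian ideal of $\Psi_{G\smallsetminus e}$, that is, to the ideal of $\mathbb{Q}[t_{e'} : e'\in E]$ generated by the partial derivatives $\partial\Psi_{G\smallsetminus e}/\partial t_{e'}$, where $G\smallsetminus e$ is $G$ with the edge $e$ deleted. Let $W_n$ be the wheel with $n$ spokes, i.e. the graph on $n+1$ vertices consisting of a cycle of length $n$, whose edges are called the rim edges, together with one additional vertex adjacent to all the vertices of the cycle. Proposition. For every integer $n>3$ and every rim edge $r$ of $W_n$, condition 1 for $(W_n,r)$ is false. -/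

import Mathlib

namespace KirchhoffCondition

/-- A multigraph is a tree if it has no self-loops and no multiple edges, and it is a tree as a
simple graph, i.e. connected (in particular nonempty) and acyclic. -/
def IsTree {α β : Type*} (G : Graph α β) : Prop :=
  G.Simple ∧ G.toSimpleGraph.IsTree

/-- `T` is (the edge set of) a spanning tree of the multigraph `G`: it consists of edges of `G`, and
the subgraph of `G` with all the vertices of `G` and with edge set `T` is a tree. -/
def IsSpanningTree {α β : Type*} (G : Graph α β) (T : Finset β) : Prop :=
  (T : Set β) ⊆ G.edgeSet ∧ IsTree (G.restrict (T : Set β))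

open Classical in
/-- The Kirchhoff polynomial `Ψ_G = ∑_T ∏_{e ∉ T} t_e` over `ℚ`, the sum over all spanning trees `T`
of `G` and the products over the edges `e` of `G` outside `T`. It is `0` if `G` is disconnected. -/
noncomputable def kirchhoff {α β : Type*} [Fintype β] (G : Graph α β) : MvPolynomial β ℚ :=
  ∑ T : Finset β with IsSpanningTree G T,
    ∏ e : β with e ∈ G.edgeSet ∧ e ∉ T, MvPolynomial.X e

/-- The Jacobian ideal of `f`: the ideal generated by all partial derivatives of `f`. -/
noncomputable def jacobianIdeal {β : Type*} (f : MvPolynomial β ℚ) : Ideal (MvPolynomial β ℚ) :=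
  Ideal.span (Set.range fun i : β => MvPolynomial.pderiv i f)

/-- Condition 1 for the edge `e` of the multigraph `G`: the Kirchhoff polynomial of `G` lies in the
Jacobian ideal of the Kirchhoff polynomial of `G` with `e` deleted. -/
def Condition1 {α β : Type*} [Fintype β] (G : Graph α β) (e : β) : Prop :=
  kirchhoff G ∈ jacobianIdeal (kirchhoff (G.deleteEdges {e}))

/-- The ends of the edges of the wheel with `n` spokes. The rim vertices are `some i`, the hub is
`none`. The edge `Sum.inl i` joins the rim vertices `i` and `i + 1` (cyclically), the edge
`Sum.inr i` joins the hub to the rim vertex `i`. -/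
def wheelEnds (n : ℕ) : Fin n ⊕ Fin n → Sym2 (Option (Fin n))
  | Sum.inl i => s(some i, some (finRotate n i))
  | Sum.inr i => s(none, some i)

/-- The wheel with `n` spokes (for `n ≥ 3`): a cycle of length `n` with an additional vertex adjacent
to all the vertices of the cycle. -/
def wheel (n : ℕ) : Graph (Option (Fin n)) (Fin n ⊕ Fin n) where
  vertexSet := Set.univ
  IsLink e x y := wheelEnds n e = s(x, y)
  edgeSet := Set.univ
  isLink_symm _ _ := ⟨fun _ _ h => h.trans Sym2.eq_swap⟩
  eq_or_eq_of_isLink_of_isLink e x y v w h h' := by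
    have h2 := h.symm.trans h'
    rw [Sym2.eq_iff] at h2
    tauto
  edge_mem_iff_exists_isLink e := by
    refine ⟨fun _ => ?_, fun _ => Set.mem_univ e⟩
    induction h : wheelEnds n e with
    | _ x y => exact ⟨x, y, rfl⟩
  left_mem_of_isLink _ _ _ _ := Set.mem_univ _

/-- The rim edges of the wheel, i.e. the edges of the cycle. -/
def rimEdges (n : ℕ) : Set (Fin n ⊕ Fin n) :=
  Set.range Sum.inl

end KirchhoffCondition

namespace KirchhoffCondition

open Finset

/-! The ideal membership is refuted by a point over `ℚ[s_i]/(s_i²)`: give spoke `i` the value `s i`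
and the rim edge from `i` to `i + 1` the value `-s i - s (i + 1)`. There every partial derivative of
the Kirchhoff polynomial of the wheel without `r` vanishes, but that of the wheel is `-2 ∏ s i ≠ 0`.

Both evaluations use a transfer matrix formula. Orienting spanning trees towards the hub turns their
weighted sum into a cyclic sum (trace) of 2×2 matrices; the trace also counts the two cyclic
orientations of the full rim, hence the correction `2 ∏ (w spoke * u rim)` in
`cyclicSum_eq_wheelTreeSum_add`. At the chosen point each rim matrix splits into two unipotent
factors, which are absorbed by the adjacent spoke matrices and make them strictly triangular. Two
such spokes joined by an unmodified rim edge have product zero, so the trace vanishes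
(`cyclicSum_eq_zero`). Deleting the rim edge `r` kills the correction; for the whole wheel the
correction survives. -/

theorem finRotate_induction {n : ℕ} (hn : 1 < n) {P : Fin n → Prop}
    (h : ∀ i, P i → P (finRotate n i)) {i : Fin n} (hi : P i) (j : Fin n) : P j := by
  obtain ⟨m, rfl⟩ : ∃ m, n = m + 2 := ⟨n - 2, by omega⟩
  have hne : ∀ x, finRotate (m + 2) x ≠ x := fun x => by simp
  obtain ⟨k, rfl⟩ := isCycle_finRotate.exists_pow_eq (hne i) (hne j)
  induction k with
  | zero => simpa using hi
  | succ k ih => rw [pow_succ', Equiv.Perm.mul_apply]; exact h _ ih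

theorem finRotate_symm_induction {n : ℕ} (hn : 1 < n) {P : Fin n → Prop}
    (h : ∀ i, P (finRotate n i) → P i) {i : Fin n} (hi : P i) (j : Fin n) : P j := by
  by_contra hj
  exact finRotate_induction hn (P := fun i => ¬ P i) (fun i hP hP' => hP (h i hP')) hj i hi

/-! ### Spanning trees of the wheel as connected sets of `n` edges. -/

theorem wheelEnds_injective {n : ℕ} (hn : 3 ≤ n) : Function.Injective (wheelEnds n) := by
  obtain ⟨m, rfl⟩ : ∃ m, n = m + 1 := ⟨n - 1, by omega⟩
  rintro (i | i) (j | j) h <;>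
    simp only [wheelEnds, Sym2.eq_iff, Option.some.injEq, reduceCtorEq, false_and, and_false,
      true_and, or_false, Sum.inl.injEq, Sum.inr.injEq] at h ⊢
  · rcases h with ⟨h, -⟩ | ⟨h, h'⟩
    · exact h
    · exfalso
      subst h
      simp only [finRotate_apply, Fin.ext_iff, Fin.val_add_one] at h'
      split_ifs at h' with h1 h2 h2 <;> simp_all <;> omega
  · exact h

theorem wheelEnds_not_isDiag {n : ℕ} (hn : 2 ≤ n) (e : Fin n ⊕ Fin n) :
    ¬ (wheelEnds n e).IsDiag := by
  obtain ⟨m, rfl⟩ : ∃ m, n = m + 2 := ⟨n - 2, by omega⟩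
  rcases e with i | i
  · simp [wheelEnds, eq_comm]
  · simp [wheelEnds]

/-- The simple graph on the vertices of the wheel formed by the edges in `T`. -/
def wheelSubgraph (n : ℕ) (T : Finset (Fin n ⊕ Fin n)) : SimpleGraph (Option (Fin n)) :=
  SimpleGraph.fromEdgeSet (wheelEnds n '' (T : Set (Fin n ⊕ Fin n)))

theorem wheelSubgraph_edgeSet {n : ℕ} (hn : 2 ≤ n) (T : Finset (Fin n ⊕ Fin n)) :
    (wheelSubgraph n T).edgeSet = wheelEnds n '' (T : Set (Fin n ⊕ Fin n)) := by
  rw [wheelSubgraph, SimpleGraph.edgeSet_fromEdgeSet, sdiff_eq_left, Set.disjoint_left]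
  rintro _ ⟨e, -, rfl⟩
  exact wheelEnds_not_isDiag hn e

theorem wheelSubgraph_adj {n : ℕ} (hn : 2 ≤ n) (T : Finset (Fin n ⊕ Fin n))
    {x y : Option (Fin n)} :
    (wheelSubgraph n T).Adj x y ↔ ∃ e ∈ T, wheelEnds n e = s(x, y) := by
  rw [← SimpleGraph.mem_edgeSet, wheelSubgraph_edgeSet hn]
  simp

theorem isSpanningTree_wheel_iff {n : ℕ} (hn : 3 ≤ n) (T : Finset (Fin n ⊕ Fin n)) :
    IsSpanningTree (wheel n) T ↔ (wheelSubgraph n T).Connected ∧ T.card = n := by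
  have hsimple : ((wheel n).restrict (T : Set (Fin n ⊕ Fin n))).Simple := by
    refine { not_isLoopAt := ?_, eq_of_isLink := ?_ }
    · rintro e x ⟨-, h⟩
      have h : wheelEnds n e = s(x, x) := h
      exact wheelEnds_not_isDiag (by omega) e (by rw [h]; simp)
    · rintro e f x y ⟨-, he⟩ ⟨-, hf⟩
      have he : wheelEnds n e = s(x, y) := he
      have hf : wheelEnds n f = s(x, y) := hf
      exact wheelEnds_injective hn (he.trans hf.symm)
  let φ : ((wheel n).restrict (T : Set (Fin n ⊕ Fin n))).toSimpleGraph ≃g wheelSubgraph n T :=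
    { toEquiv := Equiv.Set.univ _
      map_rel_iff' := by
        rintro ⟨x, hx⟩ ⟨y, hy⟩
        rw [Graph.toSimpleGraph_adj_iff]
        change (wheelSubgraph n T).Adj x y ↔ ∃ e, e ∈ T ∧ wheelEnds n e = s(x, y)
        exact wheelSubgraph_adj (by omega) T }
  have hcard : Nat.card (wheelSubgraph n T).edgeSet = T.card := by
    rw [wheelSubgraph_edgeSet (by omega), Nat.card_image_of_injective (wheelEnds_injective hn)]
    simp
  have hsub : (T : Set (Fin n ⊕ Fin n)) ⊆ (wheel n).edgeSet := fun e _ => Set.mem_univ e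
  rw [IsSpanningTree, IsTree, φ.isTree_iff, SimpleGraph.isTree_iff_connected_and_card, hcard]
  simp [hsimple, hsub]

/-! ### Encoding spanning trees by orientations towards the hub. -/

/-- The pairs of functions encoding the orientations towards the hub of sets of edges of the wheel:
`a i` says that the parent of the rim vertex `i` is its predecessor, and `b i = false` that it is
its successor. -/
def IsOrientation {n : ℕ} (a b : Fin n → Bool) : Prop :=
  ∀ i, (a i = true → b i = true) ∧ (a (finRotate n i) = true → b i = true)

/-- The edges from the rim vertices to their parents. -/
def parentEdges {n : ℕ} (a b : Fin n → Bool) : Finset (Fin n ⊕ Fin n) :=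
  (univ.filter fun i => b i = a (finRotate n i)).disjSum (univ.filter fun i => a i ≠ b i)

@[simp]
theorem inl_mem_parentEdges {n : ℕ} {a b : Fin n → Bool} {i : Fin n} :
    Sum.inl i ∈ parentEdges a b ↔ b i = a (finRotate n i) := by
  simp [parentEdges]

@[simp]
theorem inr_mem_parentEdges {n : ℕ} {a b : Fin n → Bool} {i : Fin n} :
    Sum.inr i ∈ parentEdges a b ↔ a i ≠ b i := by
  simp [parentEdges]

theorem IsOrientation.card_parentEdges {n : ℕ} {a b : Fin n → Bool} (h : IsOrientation a b) :
    (parentEdges a b).card = n := by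
  have key : ((parentEdges a b).card : ℤ) = n := by
    rw [parentEdges, card_disjSum, card_filter, card_filter]
    push_cast
    -- Given the orientation conditions, both indicators are affine in `a` and `b`, so the sum
    -- telescopes around the cycle.
    have h1 : ∀ i, (if b i = a (finRotate n i) then (1 : ℤ) else 0) =
        1 - (b i).toNat + (a (finRotate n i)).toNat := by
      intro i
      have := (h i).2
      cases hb : b i <;> cases ha : a (finRotate n i) <;> simp_all
    have h2 : ∀ i, (if a i ≠ b i then (1 : ℤ) else 0) = (b i).toNat - (a i).toNat := by
      intro i
      have := (h i).1
      cases hb : b i <;> cases ha : a i <;> simp_all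
    simp_rw [h1, h2]
    rw [sum_add_distrib, sum_sub_distrib, sum_sub_distrib,
      Equiv.sum_comp (finRotate n) (fun i => ((a i).toNat : ℤ))]
    simp
  exact_mod_cast key

/-- A rim vertex cut off from the hub has a rim parent, also cut off, whose parent lies in the same
direction. Going round the whole rim makes `a` constantly true or `b` constantly false. -/
theorem IsOrientation.connected {n : ℕ} (hn : 2 ≤ n) {a b : Fin n → Bool} (h : IsOrientation a b)
    (ha : ∃ i, a i = false) (hb : ∃ i, b i = true) :
    (wheelSubgraph n (parentEdges a b)).Connected := by
  set G := wheelSubgraph n (parentEdges a b) with hG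
  have hspoke : ∀ i, a i = false → b i = true → G.Reachable (some i) none := by
    intro i h1 h2
    refine SimpleGraph.Adj.reachable ((wheelSubgraph_adj hn _).2 ⟨Sum.inr i, ?_, ?_⟩)
    · simp [h1, h2]
    · simp [wheelEnds]
  have hrim : ∀ i, b i = a (finRotate n i) → G.Reachable (some i) (some (finRotate n i)) := by
    intro i h1
    refine SimpleGraph.Adj.reachable ((wheelSubgraph_adj hn _).2 ⟨Sum.inl i, ?_, ?_⟩)
    · simp [h1]
    · simp [wheelEnds]
  have hub : ∀ i, G.Reachable (some i) none := by
    intro i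
    by_contra hi
    have hcase : a i = true ∨ b i = false := by
      by_contra! hc
      exact hi (hspoke i (by simpa using hc.1) (by simpa using hc.2))
    rcases hcase with hai | hbi
    · obtain ⟨j, hj⟩ := ha
      have := finRotate_symm_induction (n := n) (by omega)
        (P := fun i => a i = true ∧ ¬ G.Reachable (some i) none) ?_ ⟨hai, hi⟩ j
      · simp_all
      · rintro k ⟨hk, hk'⟩
        have hbk := (h k).2 hk
        have hnr : ¬ G.Reachable (some k) none := fun hr =>
          hk' ((hrim k (hbk.trans hk.symm)).symm.trans hr)
        refine ⟨?_, hnr⟩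
        by_contra hak
        exact hnr (hspoke k (by simpa using hak) hbk)
    · obtain ⟨j, hj⟩ := hb
      have := finRotate_induction (n := n) (by omega)
        (P := fun i => b i = false ∧ ¬ G.Reachable (some i) none) ?_ ⟨hbi, hi⟩ j
      · simp_all
      · rintro k ⟨hk, hk'⟩
        have hak : a (finRotate n k) = false := by
          by_contra hc
          have := (h k).2 (by simpa using hc)
          simp_all
        have hnr : ¬ G.Reachable (some (finRotate n k)) none := fun hr =>
          hk' ((hrim k (hk.trans hak.symm)).trans hr)
        refine ⟨?_, hnr⟩
        by_contra hbk
        exact hnr (hspoke _ hak (by simpa using hbk))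
  have hub' : ∀ x, G.Reachable x none := by
    rintro (_ | i)
    · exact SimpleGraph.Reachable.refl _
    · exact hub i
  exact ⟨fun x y => (hub' x).trans (hub' y).symm⟩

/-- The parent of a rim vertex is a neighbour strictly closer to the hub. Strictness forbids two
vertices being each other's parents, and a rim vertex closest to the hub must have the hub as
parent. -/
theorem exists_orientation {n : ℕ} (hn : 2 ≤ n) {T : Finset (Fin n ⊕ Fin n)}
    (hT : (wheelSubgraph n T).Connected) (hcard : T.card = n) :
    ∃ a b : Fin n → Bool, IsOrientation a b ∧ (∃ i, a i = false) ∧ (∃ i, b i = true) ∧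
      parentEdges a b = T := by
  set G := wheelSubgraph n T with hG
  let d : Fin n → ℕ := fun i => G.dist none (some i)
  have hex : ∀ i, ∃ p : Bool × Bool,
      (p.1 = true → p.2 = true ∧ Sum.inl ((finRotate n).symm i) ∈ T ∧
        d ((finRotate n).symm i) < d i) ∧
      (p.2 = false → Sum.inl i ∈ T ∧ d (finRotate n i) < d i) ∧
      (p.1 = false → p.2 = true → Sum.inr i ∈ T) := by
    intro i
    obtain ⟨y, hadj, hdist⟩ : ∃ y, G.Adj (some i) y ∧ G.dist none y < G.dist none (some i) := by
      obtain ⟨w, hw⟩ := hT.exists_walk_length_eq_dist (some i) none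
      cases w with
      | @cons _ y _ hadj q =>
        refine ⟨y, hadj, ?_⟩
        rw [SimpleGraph.dist_comm, SimpleGraph.dist_comm (u := none), ← hw,
          SimpleGraph.Walk.length_cons]
        exact Nat.lt_succ_of_le (SimpleGraph.dist_le q)
    obtain ⟨e, heT, he⟩ := (wheelSubgraph_adj hn T).1 hadj
    rcases e with j | j
    · rw [wheelEnds, Sym2.eq_iff] at he
      rcases he with ⟨h1, h2⟩ | ⟨h1, h2⟩
      · obtain rfl : j = i := by simpa using h1
        subst h2
        exact ⟨(false, false), by simp, fun _ => ⟨heT, hdist⟩, by simp⟩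
      · obtain rfl : finRotate n j = i := by simpa using h2
        subst h1
        refine ⟨(true, true), fun _ => ⟨rfl, ?_, ?_⟩, by simp, by simp⟩
        · rwa [Equiv.symm_apply_apply]
        · rwa [Equiv.symm_apply_apply]
    · rw [wheelEnds, Sym2.eq_iff] at he
      have hj : j = i := by
        rcases he with ⟨h1, h2⟩ | ⟨h1, h2⟩
        · simp at h1
        · simpa using h2
      subst hj
      exact ⟨(false, true), by simp, by simp, fun _ _ => heT⟩
  choose p hp1 hp2 hp3 using hex
  have hor : IsOrientation (fun i => (p i).1) (fun i => (p i).2) := by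
    refine fun i => ⟨fun h => (hp1 i h).1, fun h => ?_⟩
    by_contra hb
    have h1 := (hp1 _ h).2.2
    have h2 := (hp2 i (by simpa using hb)).2
    rw [Equiv.symm_apply_apply] at h1
    omega
  have hne : (univ : Finset (Fin n)).Nonempty := ⟨⟨0, by omega⟩, mem_univ _⟩
  obtain ⟨m, -, hm⟩ := exists_min_image univ d hne
  refine ⟨_, _, hor, ⟨m, ?_⟩, ⟨m, ?_⟩, ?_⟩
  · by_contra hc
    have h1 := (hp1 m (by simpa using hc)).2.2
    have h2 := hm ((finRotate n).symm m) (mem_univ _)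
    omega
  · by_contra hc
    have h1 := (hp2 m (by simpa using hc)).2
    have h2 := hm (finRotate n m) (mem_univ _)
    omega
  · refine eq_of_subset_of_card_le ?_ (by rw [hor.card_parentEdges, hcard])
    rintro (i | i) hi
    · rw [inl_mem_parentEdges] at hi
      cases hb : (p i).2 with
      | false => exact (hp2 i hb).1
      | true =>
        have := (hp1 (finRotate n i) (hi.symm.trans hb)).2.1
        rwa [Equiv.symm_apply_apply] at this
    · rw [inr_mem_parentEdges] at hi
      cases ha : (p i).1 with
      | true => exact absurd (ha.trans (hp1 i ha).1.symm) hi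
      | false =>
        refine hp3 i ha ?_
        cases hb : (p i).2 with
        | true => rfl
        | false => exact absurd (ha.trans hb.symm) hi

/-- The edge set records which neighbours in the cyclic word `a 0, b 0, a 1, b 1, …` are equal, so
it determines the word up to complement. If a word and its complement are both orientations, the
word is constant, which `ha` and `hb` exclude. -/
theorem IsOrientation.eq_of_parentEdges_eq {n : ℕ} (hn : 2 ≤ n) {a b a' b' : Fin n → Bool}
    (h : IsOrientation a b) (h' : IsOrientation a' b') (ha : ∃ i, a i = false)
    (hb : ∃ i, b i = true) (heq : parentEdges a b = parentEdges a' b') : a = a' ∧ b = b' := by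
  have h1 : ∀ i, b i = a (finRotate n i) ↔ b' i = a' (finRotate n i) := fun i => by
    rw [← inl_mem_parentEdges, heq, inl_mem_parentEdges]
  have h2 : ∀ i, a i = b i ↔ a' i = b' i := fun i => by
    rw [← not_iff_not, ← ne_eq, ← inr_mem_parentEdges, heq, inr_mem_parentEdges]
  have key : ∀ x y x' y' : Bool, (x = y ↔ x' = y') → (x = x' ↔ y = y') := by decide
  have hab : ∀ i, a i = a' i ↔ b i = b' i := fun i => key _ _ _ _ (h2 i)
  have hba : ∀ i, b i = b' i ↔ a (finRotate n i) = a' (finRotate n i) :=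
    fun i => key _ _ _ _ (h1 i)
  by_cases hex : ∃ i, a i = a' i
  · obtain ⟨i, hi⟩ := hex
    have hall := finRotate_induction (n := n) (by omega) (P := fun i => a i = a' i)
      (fun j hj => (hba j).1 ((hab j).1 hj)) hi
    exact ⟨funext hall, funext fun j => (hab j).1 (hall j)⟩
  · push Not at hex
    exfalso
    have key' : ∀ x y x' y' : Bool, (x = true → y = true) → (x' = true → y' = true) → x ≠ x' →
        (x = x' ↔ y = y') → x = y := by decide
    have e1 : ∀ i, a i = b i := fun i => key' _ _ _ _ (h i).1 (h' i).1 (hex i) (hab i)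
    have e2 : ∀ i, a (finRotate n i) = b i :=
      fun i => key' _ _ _ _ (h i).2 (h' i).2 (hex _) (hba i).symm
    obtain ⟨i, hi⟩ := ha
    obtain ⟨j, hj⟩ := hb
    have := finRotate_induction (n := n) (by omega) (P := fun i => a i = false)
      (fun k hk => (e2 k).trans ((e1 k).symm.trans hk)) hi j
    simp [e1, hj] at this

/-! ### Transfer matrices and the vanishing of the cyclic sum. -/

section CyclicSum

variable {R : Type*} [CommRing R] {n : ℕ}

/-- The sum over all closed walks of length `2 * n` of the products of the entries of
`A 0, B 0, A 1, B 1, …` along the walk. -/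
def cyclicSum (A B : Fin n → Matrix Bool Bool R) : R :=
  ∑ a : Fin n → Bool, ∑ b : Fin n → Bool,
    ∏ i, (A i (a i) (b i) * B i (b i) (a (finRotate n i)))

theorem cyclicSum_eq_sum_mul (A B : Fin n → Matrix Bool Bool R) :
    cyclicSum A B = ∑ a : Fin n → Bool, ∏ i, (A i * B i) (a i) (a (finRotate n i)) := by
  refine sum_congr rfl fun a _ => ?_
  simp_rw [Matrix.mul_apply]
  rw [prod_univ_sum, Fintype.piFinset_univ]

theorem cyclicSum_congr_mul {A B A' B' : Fin n → Matrix Bool Bool R}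
    (h : ∀ i, A i * B i = A' i * B' i) : cyclicSum A B = cyclicSum A' B' := by
  simp_rw [cyclicSum_eq_sum_mul, h]

theorem cyclicSum_rotate (A B : Fin n → Matrix Bool Bool R) :
    cyclicSum B (fun i => A (finRotate n i)) = cyclicSum A B := by
  unfold cyclicSum
  rw [sum_comm]
  refine Fintype.sum_equiv ((finRotate n).arrowCongr (Equiv.refl Bool)) _ _ fun b =>
    sum_congr rfl fun a _ => ?_
  simp_rw [prod_mul_distrib, Equiv.arrowCongr_apply, Function.comp_apply, Equiv.refl_apply,
    Equiv.symm_apply_apply]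
  rw [mul_comm, ← Equiv.prod_comp (finRotate n) fun i => A i (b ((finRotate n).symm i)) (a i)]
  simp_rw [Equiv.symm_apply_apply]

/-- The transfer matrix of a spoke. -/
def spokeMatrix (w u : R) : Matrix Bool Bool R :=
  Matrix.of fun x y => if x = y then w else if y = true then u else 0

/-- The transfer matrix of a rim edge. -/
def rimMatrix (w u : R) : Matrix Bool Bool R :=
  Matrix.of fun x y => if x = y then u else if x = true then w else 0

theorem rimMatrix_mul (w u w' u' : R) :
    rimMatrix w u * rimMatrix w' u' = rimMatrix (w * u' + u * w') (u * u') := by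
  ext x y
  cases x <;> cases y <;> simp [rimMatrix, Matrix.mul_apply, add_comm]

theorem rimMatrix_mul_spokeMatrix_mul {s : R} (hs : s * s = 0) :
    rimMatrix (-s) 1 * spokeMatrix s 1 * rimMatrix (-s) 1 = spokeMatrix 0 1 := by
  ext x y
  cases x <;> cases y <;> simp [rimMatrix, spokeMatrix, Matrix.mul_apply, hs]

theorem cyclicSum_eq_zero {w u : Fin n ⊕ Fin n → R} {s : Fin n → R} (hs : ∀ i, s i * s i = 0)
    (hrim : ∀ i, (w (Sum.inl i) = -s i - s (finRotate n i) ∧ u (Sum.inl i) = 1) ∨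
      (w (Sum.inl i) = 1 ∧ u (Sum.inl i) = 0)) {i : Fin n}
    (hi : w (Sum.inl i) = -s i - s (finRotate n i) ∧ u (Sum.inl i) = 1)
    (hl : w (Sum.inr i) = s i ∧ u (Sum.inr i) = 1)
    (hr : w (Sum.inr (finRotate n i)) = s (finRotate n i) ∧ u (Sum.inr (finRotate n i)) = 1) :
    cyclicSum (fun i => spokeMatrix (w (Sum.inr i)) (u (Sum.inr i)))
      (fun i => rimMatrix (w (Sum.inl i)) (u (Sum.inl i))) = 0 := by
  have hE : ∀ j, ∃ E : Matrix Bool Bool R,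
      rimMatrix (w (Sum.inl j)) (u (Sum.inl j)) =
        rimMatrix (-s j) 1 * E * rimMatrix (-s (finRotate n j)) 1 ∧
      (u (Sum.inl j) = 1 → w (Sum.inl j) = -s j - s (finRotate n j) → E = rimMatrix 0 1) := by
    intro j
    rcases hrim j with ⟨h1, h2⟩ | ⟨h1, h2⟩
    · refine ⟨rimMatrix 0 1, ?_, fun _ _ => rfl⟩
      rw [rimMatrix_mul, rimMatrix_mul, h1, h2]
      congr 1 <;> ring
    -- Both alternatives can hold only in the zero ring, where `E` must still be `rimMatrix 0 1`.
    · by_cases h : u (Sum.inl j) = 1 ∧ w (Sum.inl j) = -s j - s (finRotate n j)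
      · refine ⟨rimMatrix 0 1, ?_, fun _ _ => rfl⟩
        rw [rimMatrix_mul, rimMatrix_mul, h.1, h.2]
        congr 1 <;> ring
      · refine ⟨rimMatrix 1 0, ?_, fun h3 h4 => absurd ⟨h3, h4⟩ h⟩
        rw [rimMatrix_mul, rimMatrix_mul, h1, h2]
        congr 1 <;> ring
  choose E hE hE' using hE
  have hEi := hE' i hi.2 hi.1
  let V : Fin n → Matrix Bool Bool R := fun j =>
    rimMatrix (-s j) 1 * spokeMatrix (w (Sum.inr j)) (u (Sum.inr j)) * rimMatrix (-s j) 1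
  have hV : ∀ j, w (Sum.inr j) = s j ∧ u (Sum.inr j) = 1 → V j = spokeMatrix 0 1 := fun j hj => by
    simp only [V, hj.1, hj.2]
    exact rimMatrix_mul_spokeMatrix_mul (hs j)
  have hgauge : cyclicSum (fun i => spokeMatrix (w (Sum.inr i)) (u (Sum.inr i)))
      (fun i => rimMatrix (w (Sum.inl i)) (u (Sum.inl i))) = cyclicSum V E := by
    rw [cyclicSum_congr_mul (A' := fun j =>
        spokeMatrix (w (Sum.inr j)) (u (Sum.inr j)) * rimMatrix (-s j) 1 * E j)
        (B' := fun j => rimMatrix (-s (finRotate n j)) 1)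
        (fun j => by rw [hE j]; simp only [Matrix.mul_assoc])]
    rw [cyclicSum_rotate (fun j => rimMatrix (-s j) 1)]
    exact cyclicSum_congr_mul fun j => by simp only [V, Matrix.mul_assoc]
  rw [hgauge]
  -- `E i` is the identity, and the matrices `V` on its two sides have only the entry (false, true),
  -- so no walk gets through.
  refine sum_eq_zero fun a _ => sum_eq_zero fun b _ => ?_
  by_cases h1 : b i = true
  · by_cases h2 : a (finRotate n i) = true
    · refine prod_eq_zero (mem_univ (finRotate n i)) ?_
      rw [hV _ hr, h2]
      cases b (finRotate n i) <;> simp [spokeMatrix]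
    · refine prod_eq_zero (mem_univ i) ?_
      rw [hEi, h1, Bool.eq_false_iff.2 h2]
      simp [rimMatrix]
  · refine prod_eq_zero (mem_univ i) ?_
    rw [hV _ hl, Bool.eq_false_iff.2 h1]
    simp [spokeMatrix]

end CyclicSum

/-! ### The weighted tree sum as a cyclic sum. -/

section TreeSum

variable {R : Type*} [CommRing R] {n : ℕ}

open Classical in
/-- The sum over the spanning trees of the wheel of the products of the weights `u` of their edges
and the weights `w` of the other edges. -/
noncomputable def wheelTreeSum (w u : Fin n ⊕ Fin n → R) : R :=
  ∑ T : Finset (Fin n ⊕ Fin n) with IsSpanningTree (wheel n) T, ∏ e, if e ∈ T then u e else w e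

theorem prod_transfer_eq {a b : Fin n → Bool} (h : IsOrientation a b) (w u : Fin n ⊕ Fin n → R) :
    ∏ i, (spokeMatrix (w (Sum.inr i)) (u (Sum.inr i)) (a i) (b i) *
      rimMatrix (w (Sum.inl i)) (u (Sum.inl i)) (b i) (a (finRotate n i))) =
    ∏ e, if e ∈ parentEdges a b then u e else w e := by
  rw [Fintype.prod_sum_type, ← prod_mul_distrib]
  refine prod_congr rfl fun i _ => ?_
  rw [mul_comm]
  simp only [inl_mem_parentEdges, inr_mem_parentEdges]
  have h1 := (h i).1
  have h2 := (h i).2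
  revert h1 h2
  generalize a (finRotate n i) = z
  generalize a i = x
  generalize b i = y
  cases x <;> cases y <;> cases z <;> simp [spokeMatrix, rimMatrix]

theorem prod_transfer_eq_zero {a b : Fin n → Bool} (h : ¬ IsOrientation a b)
    (w u : Fin n ⊕ Fin n → R) :
    ∏ i, (spokeMatrix (w (Sum.inr i)) (u (Sum.inr i)) (a i) (b i) *
      rimMatrix (w (Sum.inl i)) (u (Sum.inl i)) (b i) (a (finRotate n i))) = 0 := by
  rw [IsOrientation, not_forall] at h
  obtain ⟨i, hi⟩ := h
  refine prod_eq_zero (mem_univ i) ?_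
  revert hi
  generalize a (finRotate n i) = z
  generalize a i = x
  generalize b i = y
  cases x <;> cases y <;> cases z <;> simp [spokeMatrix, rimMatrix]

theorem cyclicSum_eq_wheelTreeSum_add (hn : 3 ≤ n) (w u : Fin n ⊕ Fin n → R) :
    cyclicSum (fun i => spokeMatrix (w (Sum.inr i)) (u (Sum.inr i)))
      (fun i => rimMatrix (w (Sum.inl i)) (u (Sum.inl i))) =
    wheelTreeSum w u + 2 * ∏ i, (w (Sum.inr i) * u (Sum.inl i)) := by
  classical
  let F : (Fin n → Bool) × (Fin n → Bool) → R := fun p =>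
    ∏ i, (spokeMatrix (w (Sum.inr i)) (u (Sum.inr i)) (p.1 i) (p.2 i) *
      rimMatrix (w (Sum.inl i)) (u (Sum.inl i)) (p.2 i) (p.1 (finRotate n i)))
  -- The two constant words orient the rim as a cycle: the only orientations that do not come from
  -- trees.
  let c : Bool → (Fin n → Bool) × (Fin n → Bool) := fun x => (fun _ => x, fun _ => x)
  let S : Finset ((Fin n → Bool) × (Fin n → Bool)) :=
    {p | IsOrientation p.1 p.2 ∧ (∃ i, p.1 i = false) ∧ ∃ i, p.2 i = true}
  have hsum : cyclicSum (fun i => spokeMatrix (w (Sum.inr i)) (u (Sum.inr i)))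
      (fun i => rimMatrix (w (Sum.inl i)) (u (Sum.inl i))) = ∑ p, F p :=
    (Fintype.sum_prod_type F).symm
  have hF : ∀ x, F (c x) = ∏ i, (w (Sum.inr i) * u (Sum.inl i)) := fun x => by
    simp [F, c, spokeMatrix, rimMatrix]
  have hcne : c true ≠ c false := fun h => by
    have := congrFun (congrArg Prod.fst h) ⟨0, by omega⟩
    simp [c] at this
  have hdisj : Disjoint S {c true, c false} := by
    rw [Finset.disjoint_right]
    intro p hp
    rcases mem_insert.1 hp with rfl | hp
    · simp [S, c]
    · rw [mem_singleton.1 hp]; simp [S, c]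
  have hsupp : ∑ p ∈ S ∪ {c true, c false}, F p = ∑ p, F p := by
    refine sum_subset (subset_univ _) fun p _ hp => ?_
    refine prod_transfer_eq_zero (fun hor => hp ?_) w u
    simp only [mem_union, mem_insert, mem_singleton]
    by_cases h1 : ∃ i, p.1 i = false
    · by_cases h2 : ∃ i, p.2 i = true
      · exact Or.inl (mem_filter.2 ⟨mem_univ _, hor, h1, h2⟩)
      · push Not at h2
        refine Or.inr (Or.inr (Prod.ext (funext fun i => ?_) (funext fun i => ?_)))
        · exact Bool.eq_false_iff.2 fun h => h2 i ((hor i).1 h)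
        · exact Bool.eq_false_iff.2 (h2 i)
    · push Not at h1
      have h1 : ∀ i, p.1 i = true := fun i => by simpa using h1 i
      exact Or.inr (Or.inl (Prod.ext (funext h1) (funext fun i => (hor i).1 (h1 i))))
  have htree : ∑ p ∈ S, F p = wheelTreeSum w u := by
    refine sum_bij (fun p _ => parentEdges p.1 p.2) ?_ ?_ ?_ ?_
    · intro p hp
      obtain ⟨-, hor, ha, hb⟩ := mem_filter.1 hp
      exact mem_filter.2 ⟨mem_univ _, (isSpanningTree_wheel_iff hn _).2
        ⟨hor.connected (by omega) ha hb, hor.card_parentEdges⟩⟩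
    · intro p hp q hq heq
      obtain ⟨-, hor, ha, hb⟩ := mem_filter.1 hp
      obtain ⟨-, hor', -, -⟩ := mem_filter.1 hq
      obtain ⟨h1, h2⟩ := hor.eq_of_parentEdges_eq (by omega) hor' ha hb heq
      exact Prod.ext h1 h2
    · intro T hT
      obtain ⟨hconn, hcard⟩ := (isSpanningTree_wheel_iff hn T).1 (mem_filter.1 hT).2
      obtain ⟨a, b, hor, ha, hb, h⟩ := exists_orientation (by omega) hconn hcard
      exact ⟨(a, b), mem_filter.2 ⟨mem_univ _, hor, ha, hb⟩, h⟩
    · intro p hp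
      exact prod_transfer_eq (mem_filter.1 hp).2.1 w u
  rw [hsum, ← hsupp, sum_union hdisj, htree, sum_pair hcne, hF, hF, two_mul]

end TreeSum

/-! ### Evaluating the Kirchhoff polynomial and its derivatives. -/

section Kirchhoff

open MvPolynomial

theorem pderiv_prod_X {β : Type*} [DecidableEq β] (i : β) (S : Finset β) :
    pderiv i (∏ e ∈ S, (X e : MvPolynomial β ℚ)) =
      if i ∈ S then ∏ e ∈ S.erase i, X e else 0 := by
  have h0 : ∀ S : Finset β, i ∉ S → pderiv i (∏ e ∈ S, (X e : MvPolynomial β ℚ)) = 0 := by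
    intro S
    induction S using Finset.induction_on with
    | empty => simp
    | insert a S ha ih =>
      intro hi
      rw [mem_insert, not_or] at hi
      rw [prod_insert ha, Derivation.leibniz, ih hi.2, pderiv_X_of_ne (Ne.symm hi.1)]
      simp
  split_ifs with hi
  · rw [← mul_prod_erase S _ hi, Derivation.leibniz, h0 _ (notMem_erase i S)]
    simp
  · exact h0 S hi

variable {R : Type*} [CommRing R] [Algebra ℚ R] {n : ℕ}

theorem aeval_kirchhoff_wheel (w : Fin n ⊕ Fin n → R) :
    aeval w (kirchhoff (wheel n)) = wheelTreeSum w 1 := by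
  classical
  rw [kirchhoff, map_sum, wheelTreeSum]
  refine sum_congr (by congr) fun T _ => ?_
  have hE : ∀ e, e ∈ (wheel n).edgeSet := fun e => Set.mem_univ e
  simp only [hE, true_and, map_prod, prod_filter, ite_not, Pi.one_apply]
  refine prod_congr rfl fun e _ => ?_
  split_ifs <;> simp

theorem isSpanningTree_deleteEdges_iff {α β : Type*} (G : Graph α β) (r : β) (T : Finset β) :
    IsSpanningTree (G.deleteEdges {r}) T ↔ IsSpanningTree G T ∧ r ∉ T := by
  have hE : (G.deleteEdges {r}).edgeSet = G.edgeSet \ {r} := rfl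
  have hsub : ((T : Set β) ⊆ G.edgeSet \ {r}) ↔ (T : Set β) ⊆ G.edgeSet ∧ r ∉ T := by
    rw [Set.subset_sdiff]; simp
  rw [IsSpanningTree, IsSpanningTree, hE, hsub]
  have hres : (T : Set β) ⊆ G.edgeSet → r ∉ T →
      (G.deleteEdges {r}).restrict (T : Set β) = G.restrict (T : Set β) := by
    intro h1 h2
    rw [← Graph.restrict_edgeSet_sdiff_eq_deleteEdges, Graph.restrict_restrict,
      Set.inter_eq_right.2 (hsub.2 ⟨h1, h2⟩)]
  constructor
  · rintro ⟨⟨h1, h2⟩, h3⟩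
    exact ⟨⟨h1, hres h1 h2 ▸ h3⟩, h2⟩
  · rintro ⟨⟨h1, h3⟩, h2⟩
    exact ⟨⟨h1, h2⟩, (hres h1 h2).symm ▸ h3⟩

/-- Only the trees avoiding both `i` and `r` contribute, and neither variable remains in their
monomials. -/
theorem aeval_pderiv_kirchhoff_wheel_deleteEdges (w : Fin n ⊕ Fin n → R) {r i : Fin n ⊕ Fin n}
    (hir : i ≠ r) :
    aeval w (pderiv i (kirchhoff ((wheel n).deleteEdges {r}))) =
      wheelTreeSum (fun e => if e = i ∨ e = r then 1 else w e)
        (fun e => if e = i ∨ e = r then 0 else 1) := by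
  classical
  rw [kirchhoff, map_sum, map_sum, wheelTreeSum]
  simp only [isSpanningTree_deleteEdges_iff]
  rw [← filter_filter, sum_filter]
  refine sum_congr (by congr) fun T _ => ?_
  have hE : ∀ e, e ∈ ((wheel n).deleteEdges {r}).edgeSet ↔ e ≠ r := fun e => by
    change e ∈ Set.univ \ {r} ↔ _
    simp
  by_cases hr : r ∈ T
  · rw [if_neg (not_not.2 hr), prod_eq_zero (mem_univ r)]
    simp [hr]
  by_cases hi : i ∈ T
  · rw [if_pos hr, prod_eq_zero (mem_univ i) (by simp [hi]), pderiv_prod_X, if_neg, map_zero]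
    simp [hi]
  rw [if_pos hr, pderiv_prod_X, if_pos (by simp [hi, hir]; exact Set.mem_univ i),
    map_prod]
  simp_rw [aeval_X]
  refine prod_subset_one_on_sdiff (subset_univ _) (fun e he => ?_) fun e he => ?_
  · simp only [mem_sdiff, mem_univ, mem_erase, mem_filter, hE, true_and] at he
    by_cases h1 : e = i
    · simp [h1, hi]
    · by_cases h2 : e = r
      · simp [h2, hr]
      · simp [h1, h2] at he
        simp [h1, h2, he]
  · simp only [mem_univ, mem_erase, mem_filter, hE, true_and] at he
    simp [he.1, he.2.1, he.2.2]

theorem pderiv_kirchhoff_deleteEdges_self {α β : Type*} [Fintype β] (G : Graph α β) (r : β) :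
    pderiv r (kirchhoff (G.deleteEdges {r})) = 0 := by
  classical
  rw [kirchhoff, map_sum]
  refine sum_eq_zero fun T _ => ?_
  rw [pderiv_prod_X, if_neg]
  simp

end Kirchhoff

/-! ### The evaluation point and the conclusion. -/

theorem exists_sq_zero_ring (n : ℕ) : ∃ (R : Type) (_ : CommRing R) (_ : Algebra ℚ R)
    (s : Fin n → R), (∀ i, s i * s i = 0) ∧ ∏ i, s i ≠ 0 := by
  let I : Ideal (MvPolynomial (Fin n) ℚ) :=
    Ideal.span ((fun m => MvPolynomial.monomial m (1 : ℚ)) ''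
      Set.range fun i => Finsupp.single i 2)
  refine ⟨MvPolynomial (Fin n) ℚ ⧸ I, inferInstance, inferInstance,
    fun i => Ideal.Quotient.mk I (MvPolynomial.X i), fun i => ?_, ?_⟩
  · rw [← map_mul, Ideal.Quotient.eq_zero_iff_mem]
    refine Ideal.subset_span ⟨_, ⟨i, rfl⟩, ?_⟩
    rw [← sq, MvPolynomial.X_pow_eq_monomial]
  · rw [← map_prod, Ne, Ideal.Quotient.eq_zero_iff_mem,
      MvPolynomial.mem_ideal_span_monomial_image]
    have hmon : ∏ i : Fin n, (MvPolynomial.X i : MvPolynomial (Fin n) ℚ) =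
        MvPolynomial.monomial (∑ i, Finsupp.single i 1) 1 := by
      rw [MvPolynomial.monomial_sum_one]; rfl
    intro h
    obtain ⟨_, ⟨i, rfl⟩, hi⟩ := h (∑ i, Finsupp.single i 1) (by
      rw [hmon, MvPolynomial.mem_support_iff, MvPolynomial.coeff_monomial]; simp)
    have := hi i
    simp [Finsupp.finsetSum_apply, Finsupp.single_apply] at this

/-- This is where `n > 3` enters: a spoke `x` spoils the two rim edges at its rim end, and `r` is a
third. -/
theorem exists_rim_avoiding {n : ℕ} (hn : 3 < n) (r : Fin n) (x : Fin n ⊕ Fin n) :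
    ∃ i, i ≠ r ∧ Sum.inl i ≠ x ∧ Sum.inr i ≠ x ∧ Sum.inr (finRotate n i) ≠ x := by
  have key : ∀ j k : Fin n, ∃ i, i ≠ r ∧ i ≠ j ∧ i ≠ k := by
    intro j k
    obtain ⟨i, -, hi⟩ := exists_mem_notMem_of_card_lt_card (s := {r, j, k}) (t := univ)
      (by have := card_le_three (a := r) (b := j) (c := k); rw [card_univ, Fintype.card_fin]; omega)
    simp only [mem_insert, mem_singleton, not_or] at hi
    exact ⟨i, hi⟩
  rcases x with j | j
  · obtain ⟨i, h1, h2, -⟩ := key j j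
    exact ⟨i, h1, by simpa using h2, by simp, by simp⟩
  · obtain ⟨i, h1, h2, h3⟩ := key j ((finRotate n).symm j)
    refine ⟨i, h1, by simp, by simpa using h2, fun h => h3 ?_⟩
    rw [Sum.inr.injEq] at h
    rw [← h, Equiv.symm_apply_apply]

end KirchhoffCondition

theorem mainTheorem3 (n : ℕ) (hn : 3 < n) (r : Fin n ⊕ Fin n)
    (hr : r ∈ KirchhoffCondition.rimEdges n) :
    ¬ KirchhoffCondition.Condition1 (KirchhoffCondition.wheel n) r := by
  open KirchhoffCondition in
  obtain ⟨r, rfl⟩ := hr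
  obtain ⟨R, _, _, s, hs, hprod⟩ := exists_sq_zero_ring n
  let w : Fin n ⊕ Fin n → R := Sum.elim (fun i => -s i - s (finRotate n i)) s
  intro hcond
  have hJ : jacobianIdeal (kirchhoff ((wheel n).deleteEdges {Sum.inl r})) ≤
      RingHom.ker (MvPolynomial.aeval (R := ℚ) w) := by
    rw [jacobianIdeal, Ideal.span_le]
    rintro _ ⟨x, rfl⟩
    change MvPolynomial.aeval w (MvPolynomial.pderiv x _) = 0
    by_cases hx : x = Sum.inl r
    · rw [hx, pderiv_kirchhoff_deleteEdges_self, map_zero]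
    obtain ⟨i, h1, h2, h3, h4⟩ := exists_rim_avoiding hn r x
    rw [aeval_pderiv_kirchhoff_wheel_deleteEdges w hx]
    set w' : Fin n ⊕ Fin n → R := fun e => if e = x ∨ e = Sum.inl r then 1 else w e with hw'
    set u' : Fin n ⊕ Fin n → R := fun e => if e = x ∨ e = Sum.inl r then 0 else 1 with hu'
    have hsum := cyclicSum_eq_wheelTreeSum_add (by omega) w' u'
    -- The correction vanishes because the deleted rim edge `r` has `u' = 0`.
    rw [cyclicSum_eq_zero (s := s) (i := i) hs, Finset.prod_eq_zero (Finset.mem_univ r),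
      mul_zero, add_zero] at hsum
    · exact hsum.symm
    · simp [hu']
    · intro j
      by_cases hj : Sum.inl j = x ∨ j = r
      · right; simp [hj, hw', hu']
      · left; simp [hj, hw', hu', w]
    · simp [h1, h2, w, hw', hu']
    · simp [h3, w, hw', hu']
    · simp only [hw', hu', h4, reduceCtorEq, or_self, if_false, w, Sum.elim_inr, and_self]
  have h0 : MvPolynomial.aeval w (kirchhoff (wheel n)) = 0 := hJ hcond
  have hsum := cyclicSum_eq_wheelTreeSum_add (R := R) (n := n) (by omega) w 1
  rw [cyclicSum_eq_zero (s := s) (i := r) hs (fun j => Or.inl ⟨rfl, rfl⟩) ⟨rfl, rfl⟩ ⟨rfl, rfl⟩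
    ⟨rfl, rfl⟩, ← aeval_kirchhoff_wheel, h0, zero_add] at hsum
  apply hprod
  have h2 : (2 : R) * ∏ i, s i = 0 := by simpa [w] using hsum.symm
  have hu : algebraMap ℚ R (1 / 2) * 2 = 1 := by
    rw [← map_ofNat (algebraMap ℚ R) 2, ← map_mul]; norm_num
  rw [← one_mul (∏ i, s i), ← hu, mul_assoc, h2, mul_zero]
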